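/- For a measurable set $E\subset\mathbb{R}^d$ $(d \ge 2)$ and a unit vector $\theta\in S^{d-1}$, the Radon transform of the characteristic function $\chi_E$ in direction $\theta$ is the function $R_\theta\chi_E:\mathbb{R}\to[0,\infty]$, $$(R_\theta\chi_E)(r)=\lambda^{d-1}\bigl(E\cap\{x\in\mathbb{R}^d:\langle x,\theta\rangle=r\}\bigr),$$ where $\lambda^{d-1}$ denotes $(d-1)$-dimensional Lebesgue measure on hyperplanes. Theorem. There exists a bounded measurable set $K\subset\mathbb{R}^2$ such that for every direction $\theta\in S^1$ the Radon transform $R_\theta\chi_K$ does not agree (Lebesgue) almost everywhere with a continuous function. In particular, for every $\theta\in S^1$, $R_\theta\chi_K$ does not agree almost everywhere with a function $\mathbb{R}\to\mathbb{R}$ that is absolutely continuous on every compact interval. -/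

import Mathlib

open MeasureTheory
open scoped ENNReal RealInnerProductSpace

/-- The Radon transform of the characteristic function of a set `E ⊆ ℝ^d` in the direction of the
unit vector `θ`, that is, the measure function of the sections of `E`:
`(R_θ χ_E)(r) = λ^{d-1}(E ∩ {x | ⟨x, θ⟩ = r})`.
Here `λ^{d-1}` is Lebesgue measure on hyperplanes, which is Mathlib's normalized
Hausdorff measure `μHE[d - 1]`. The values lie in `[0, ∞]`. -/
noncomputable def radonTransform {d : ℕ} (E : Set (EuclideanSpace ℝ (Fin d)))
    (θ : EuclideanSpace ℝ (Fin d)) (r : ℝ) : ℝ≥0∞ :=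
  Measure.euclideanHausdorffMeasure (d - 1) (E ∩ {x | ⟪x, θ⟫ = r})

/-! By Tonelli, the average of `radonTransform K θ` over a ball about `r₀` is a strip density of `K`
around the line `⟪x, θ⟫ = r₀`. If these averages oscillate as the strip shrinks, no continuous
representative exists (`not_ae_eq_continuous_of_average_oscillation`). So `K` must have, in each
direction, a line with oscillating strip densities.

Such lines come from a Kakeya-type family `y = a x + b a` with neighbourhoods `S h` of measure
tending to zero (`exists_intercept_volume_lineFamilyNhd_le`). With widths `u n` decreasing so fast
that `S (u (n + 1))` has measure at most `s * u n`, take `T = ⋃ k, S (u (2k)) \ S (u (2k+1))`. At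
width `u (2k)` a strip about a line of the family loses little of its measure `4 * s * u (2k)`; at
width `u (2k+1)` it meets `T` only inside `S (u (2k+2))`. Two copies of `T`, one with swapped axes,
serve all directions. -/

open Filter Topology Set

/-! ### Strip measures as integrals of the Radon transform -/

/-- Orthogonal coordinates of the plane adapted to a unit vector `θ`. -/
theorem exists_measurePreserving_frame (θ : EuclideanSpace ℝ (Fin 2)) (hθ : ‖θ‖ = 1) :
    ∃ F : ℝ × ℝ → EuclideanSpace ℝ (Fin 2), MeasurePreserving F ∧
      (∀ r, Isometry fun t => F (r, t)) ∧ (∀ p, ⟪F p, θ⟫ = p.1) ∧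
      ∀ x, ∃ t, F (⟪x, θ⟫, t) = x := by
  have hv : Orthonormal ℝ (({0} : Set (Fin 2)).domRestrict fun _ => θ) := by
    refine ⟨fun _ => hθ, fun i j hij => absurd (Subsingleton.elim i j) hij⟩
  obtain ⟨b, hb⟩ := hv.exists_orthonormalBasis_extension_of_card_eq (by simp)
  have hb0 : b 0 = θ := hb 0 rfl
  have hin : ⟪b 1, b 0⟫ = 0 := by
    rw [b.inner_eq_ite]; simp
  have hn0 : ⟪b 0, b 0⟫ = 1 := by rw [b.inner_eq_ite]; simp
  refine ⟨fun p => p.1 • b 0 + p.2 • b 1, ?_, ?_, ?_, ?_⟩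
  · have h := (b.measurePreserving_repr_symm.comp (PiLp.volume_preserving_toLp (Fin 2))).comp
      (volume_preserving_finTwoArrow ℝ).symm
    have hF : (fun p : ℝ × ℝ => p.1 • b 0 + p.2 • b 1) =
        (b.repr.symm ∘ WithLp.toLp 2) ∘ MeasurableEquiv.finTwoArrow.symm := by
      funext p
      simp [← OrthonormalBasis.sum_repr_symm, Fin.sum_univ_two, MeasurableEquiv.finTwoArrow]
    rw [hF]
    exact h
  · intro r
    refine Isometry.of_dist_eq fun s t => ?_
    rw [dist_eq_norm, add_sub_add_left_eq_sub, ← sub_smul, norm_smul, b.norm_eq_one, mul_one,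
      Real.dist_eq, Real.norm_eq_abs]
  · intro p
    rw [← hb0, inner_add_left, inner_smul_left, inner_smul_left, hin, hn0]
    simp
  · intro x
    refine ⟨⟪b 1, x⟫, ?_⟩
    have := b.sum_repr' x
    rw [Fin.sum_univ_two] at this
    simpa [← hb0, real_inner_comm] using this

theorem lintegral_radonTransform_ball {K : Set (EuclideanSpace ℝ (Fin 2))} (hK : MeasurableSet K)
    {θ : EuclideanSpace ℝ (Fin 2)} (hθ : ‖θ‖ = 1) (r₀ ρ : ℝ) :
    ∫⁻ r in Metric.ball r₀ ρ, radonTransform K θ r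
      = volume (K ∩ {x | |⟪x, θ⟫ - r₀| < ρ}) := by
  obtain ⟨F, hF, hiso, hin, hsurj⟩ := exists_measurePreserving_frame θ hθ
  have hR : ∀ r, radonTransform K θ r = volume {t | F (r, t) ∈ K} := by
    intro r
    have himg : K ∩ {x | ⟪x, θ⟫ = r} = (fun t => F (r, t)) '' {t | F (r, t) ∈ K} := by
      ext x
      constructor
      · rintro ⟨hx, rfl⟩
        obtain ⟨t, ht⟩ := hsurj x
        exact ⟨t, by simpa [ht] using hx, ht⟩
      · rintro ⟨t, ht, rfl⟩
        exact ⟨ht, hin _⟩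
    have hvol := InnerProductSpace.euclideanHausdorffMeasure_eq_volume (V := ℝ)
    rw [Module.finrank_self] at hvol
    unfold radonTransform
    rw [himg, (hiso r).euclideanHausdorffMeasure_image]
    change Measure.euclideanHausdorffMeasure 1 _ = _
    rw [hvol]
  have hS : MeasurableSet (K ∩ {x : EuclideanSpace ℝ (Fin 2) | |⟪x, θ⟫ - r₀| < ρ}) := by
    refine hK.inter (IsOpen.measurableSet ?_)
    exact isOpen_lt (by fun_prop) continuous_const
  rw [← hF.measure_preimage hS.nullMeasurableSet, Measure.volume_eq_prod,
    Measure.prod_apply (hF.measurable hS), ← lintegral_indicator Metric.isOpen_ball.measurableSet]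
  refine lintegral_congr fun r => ?_
  by_cases hr : r ∈ Metric.ball r₀ ρ
  · rw [indicator_of_mem hr, hR]
    congr 1
    ext t
    simpa [hin, Real.dist_eq] using fun _ => hr
  · rw [indicator_of_notMem hr]
    symm
    convert measure_empty (μ := (volume : Measure ℝ))
    ext t
    simpa [hin, Real.dist_eq] using fun _ => hr

/-- Averages of a continuous `g` over balls shrinking to `r₀` converge to `g r₀`, which is either
below `β` or above `α`; each case contradicts one of the frequent bounds. -/
theorem not_ae_eq_continuous_of_average_oscillation {f : ℝ → ℝ≥0∞} {r₀ : ℝ} {α β : ℝ≥0∞}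
    (hαβ : α < β)
    (hβ : ∃ᶠ ρ in 𝓝[>] (0 : ℝ),
      β * volume (Metric.ball r₀ ρ) ≤ ∫⁻ r in Metric.ball r₀ ρ, f r)
    (hα : ∃ᶠ ρ in 𝓝[>] (0 : ℝ),
      ∫⁻ r in Metric.ball r₀ ρ, f r ≤ α * volume (Metric.ball r₀ ρ)) :
    ¬ ∃ g : ℝ → ℝ≥0∞, Continuous g ∧ f =ᵐ[volume] g := by
  rintro ⟨g, hg, hfg⟩
  have hfg' : ∀ ρ, ∫⁻ r in Metric.ball r₀ ρ, f r = ∫⁻ r in Metric.ball r₀ ρ, g r := fun ρ =>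
    lintegral_congr_ae (ae_restrict_of_ae hfg)
  simp only [hfg'] at hα hβ
  have hball : ∀ s ∈ 𝓝 r₀, ∀ᶠ ρ in 𝓝[>] (0 : ℝ), Metric.ball r₀ ρ ⊆ s := by
    intro s hs
    obtain ⟨ε, hε, h⟩ := Metric.mem_nhds_iff.1 hs
    filter_upwards [Ioo_mem_nhdsGT hε] with ρ hρ
    exact (Metric.ball_subset_ball hρ.2.le).trans h
  have hpos : ∀ ρ : ℝ, 0 < ρ → volume (Metric.ball r₀ ρ) ≠ 0 := fun ρ hρ =>
    (Metric.measure_ball_pos volume r₀ hρ).ne'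
  have hfin : ∀ ρ : ℝ, volume (Metric.ball r₀ ρ) ≠ ∞ := fun ρ => measure_ball_lt_top.ne
  rcases lt_or_ge (g r₀) β with h | h
  · obtain ⟨c, hc, hcβ⟩ := exists_between h
    obtain ⟨ρ, hle, hsub, hρ⟩ := (hβ.and_eventually
      ((hball _ (hg.continuousAt.eventually_lt_const hc)).and self_mem_nhdsWithin)).exists
    refine (lt_irrefl (β * volume (Metric.ball r₀ ρ))) (hle.trans_lt ?_)
    calc ∫⁻ r in Metric.ball r₀ ρ, g r ≤ ∫⁻ r in Metric.ball r₀ ρ, c :=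
          setLIntegral_mono measurable_const fun r hr => (hsub hr).le
      _ = c * volume (Metric.ball r₀ ρ) := setLIntegral_const _ _
      _ < _ := ENNReal.mul_lt_mul_left (hpos ρ hρ) (hfin ρ) hcβ
  · obtain ⟨c, hαc, hc⟩ := exists_between (hαβ.trans_le h)
    obtain ⟨ρ, hle, hsub, hρ⟩ := (hα.and_eventually
      ((hball _ (hg.continuousAt.eventually_const_lt hc)).and self_mem_nhdsWithin)).exists
    refine (lt_irrefl (α * volume (Metric.ball r₀ ρ))) (lt_of_lt_of_le ?_ hle)
    calc α * volume (Metric.ball r₀ ρ) < c * volume (Metric.ball r₀ ρ) :=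
          ENNReal.mul_lt_mul_left (hpos ρ hρ) (hfin ρ) hαc
      _ = ∫⁻ r in Metric.ball r₀ ρ, c := (setLIntegral_const _ _).symm
      _ ≤ _ := setLIntegral_mono hg.measurable fun r hr => (hsub hr).le

/-! ### Dyadic truncation of slopes -/

/-- The largest multiple of `2⁻ⁿ` that is at most `a`. -/
noncomputable def dyadicFloor (n : ℕ) (a : ℝ) : ℝ := ⌊a * 2 ^ n⌋ / 2 ^ n

theorem dyadicFloor_le (n : ℕ) (a : ℝ) : dyadicFloor n a ≤ a := by
  rw [dyadicFloor, div_le_iff₀ (by positivity)]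
  exact Int.floor_le _

theorem sub_dyadicFloor_le (n : ℕ) (a : ℝ) : a - dyadicFloor n a ≤ (1 / 2) ^ n := by
  have h2 : (0 : ℝ) < 2 ^ n := by positivity
  have h := (Int.lt_floor_add_one (a * 2 ^ n)).le
  rw [dyadicFloor, one_div, inv_pow, sub_le_iff_le_add, ← one_div, ← add_div, le_div_iff₀ h2]
  linarith

theorem dyadicFloor_dyadicFloor {m n : ℕ} (h : m ≤ n) (a : ℝ) :
    dyadicFloor m (dyadicFloor n a) = dyadicFloor m a := by
  obtain ⟨k, rfl⟩ := Nat.exists_eq_add_of_le h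
  have key : ∀ z : ℝ, z / 2 ^ (m + k) * 2 ^ m = z / ((2 ^ k : ℕ) : ℝ) := by
    intro z
    push_cast
    rw [pow_add]
    field_simp
  have h2 : ⌊(⌊a * 2 ^ (m + k)⌋ : ℝ) / 2 ^ (m + k) * 2 ^ m⌋ = ⌊a * 2 ^ m⌋ := by
    have h3 : a * 2 ^ m = a * 2 ^ (m + k) / 2 ^ (m + k) * 2 ^ m := by field_simp
    rw [h3, key, key, Int.floor_div_natCast, Int.floor_div_natCast, Int.floor_intCast]
  simp only [dyadicFloor, h2]

theorem dyadicFloor_mono {m n : ℕ} (h : m ≤ n) (a : ℝ) : dyadicFloor m a ≤ dyadicFloor n a := by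
  rw [← dyadicFloor_dyadicFloor h]
  exact dyadicFloor_le _ _

theorem tendsto_dyadicFloor (a : ℝ) : Tendsto (fun n => dyadicFloor n a) atTop (𝓝 a) := by
  have h : Tendsto (fun n : ℕ => a - (1 / 2 : ℝ) ^ n) atTop (𝓝 (a - 0)) :=
    (tendsto_pow_atTop_nhds_zero_of_lt_one (by norm_num) (by norm_num)).const_sub a
  rw [sub_zero] at h
  exact tendsto_of_tendsto_of_tendsto_of_le_of_le h tendsto_const_nhds
    (fun n => by linarith [sub_dyadicFloor_le n a]) fun n => dyadicFloor_le n a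

/-! ### A Kakeya-type line family with null union -/

/-- The intercept of the line of slope `a` in the Kakeya-type family in which the `n`-th binary
digit of the slope rotates lines about the abscissa `c n`. -/
noncomputable def kakeyaIntercept (c : ℕ → ℝ) (a : ℝ) : ℝ :=
  -∑' n, c n * (dyadicFloor (n + 1) a - dyadicFloor n a)

/-- The height at abscissa `x` of the `m`-th dyadic approximation of the line of slope `a`. -/
noncomputable def kakeyaApprox (c : ℕ → ℝ) (x : ℝ) (m : ℕ) (a : ℝ) : ℝ :=
  dyadicFloor m a * x - ∑ n ∈ Finset.range m, c n * (dyadicFloor (n + 1) a - dyadicFloor n a)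

/-- Only the first `m` digits enter, so finitely many heights occur for `|a| ≤ 1`; these are the
centres of the later covering. -/
theorem kakeyaApprox_dyadicFloor (c : ℕ → ℝ) (x : ℝ) (m : ℕ) (a : ℝ) :
    kakeyaApprox c x m (dyadicFloor m a) = kakeyaApprox c x m a := by
  unfold kakeyaApprox
  rw [dyadicFloor_dyadicFloor le_rfl]
  congr 1
  refine Finset.sum_congr rfl fun n hn => ?_
  have hn := Finset.mem_range.1 hn
  rw [dyadicFloor_dyadicFloor (by omega), dyadicFloor_dyadicFloor hn.le]

theorem tendsto_kakeyaApprox {c : ℕ → ℝ} {s : ℝ} (hc : ∀ n, |c n| ≤ s) (x a : ℝ) :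
    Tendsto (fun m => kakeyaApprox c x m a) atTop (𝓝 (a * x + kakeyaIntercept c a)) := by
  have hs : Summable fun n => c n * (dyadicFloor (n + 1) a - dyadicFloor n a) := by
    refine Summable.of_norm_bounded
      ((summable_geometric_of_lt_one (by norm_num) (by norm_num : (1 / 2 : ℝ) < 1)).mul_left s)
      fun n => ?_
    have h1 := dyadicFloor_mono n.le_succ a
    have h2 := sub_dyadicFloor_le n a
    have h3 := dyadicFloor_le (n + 1) a
    rw [norm_mul, Real.norm_eq_abs, Real.norm_eq_abs, abs_of_nonneg (sub_nonneg.2 h1)]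
    exact mul_le_mul (hc n) (by linarith) (sub_nonneg.2 h1) ((abs_nonneg _).trans (hc n))
  unfold kakeyaApprox kakeyaIntercept
  rw [← sub_eq_add_neg]
  exact ((tendsto_dyadicFloor a).mul_const x).sub hs.hasSum.tendsto_sum_nat

/-- Digit `n` moves the height by `x - c n` times a nonnegative increment, and the increments
telescope. Digits whose pivot is close to `x` hardly matter. -/
theorem abs_kakeyaApprox_sub_le {c : ℕ → ℝ} {x ε : ℝ} {m N : ℕ} (hmN : m ≤ N)
    (hc : ∀ n, m ≤ n → n < N → |x - c n| ≤ ε) (a : ℝ) :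
    |kakeyaApprox c x N a - kakeyaApprox c x m a| ≤ ε * (dyadicFloor N a - dyadicFloor m a) := by
  induction N, hmN using Nat.le_induction with
  | base => simp
  | succ N hN ih =>
    have h1 := ih fun n hn hn' => hc n hn (hn'.trans N.lt_succ_self)
    have h2 := hc N hN N.lt_succ_self
    have h3 : kakeyaApprox c x (N + 1) a - kakeyaApprox c x N a
        = (x - c N) * (dyadicFloor (N + 1) a - dyadicFloor N a) := by
      unfold kakeyaApprox
      rw [Finset.sum_range_succ]
      ring
    have h4 := sub_nonneg.2 (dyadicFloor_mono N.le_succ a)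
    calc _ ≤ |kakeyaApprox c x (N + 1) a - kakeyaApprox c x N a|
          + |kakeyaApprox c x N a - kakeyaApprox c x m a| := abs_sub_le _ _ _
      _ ≤ ε * (dyadicFloor (N + 1) a - dyadicFloor N a)
          + ε * (dyadicFloor N a - dyadicFloor m a) := by
        refine add_le_add ?_ h1
        rw [h3, abs_mul, abs_of_nonneg h4]
        exact mul_le_mul_of_nonneg_right h2 h4
      _ = _ := by ring

theorem abs_sub_kakeyaApprox_le {c : ℕ → ℝ} {s x ε : ℝ} (hs : ∀ n, |c n| ≤ s) (m : ℕ)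
    (hc : ∀ n, m ≤ n → |x - c n| ≤ ε) (a : ℝ) :
    |a * x + kakeyaIntercept c a - kakeyaApprox c x m a| ≤ ε * (1 / 2) ^ m := by
  have hε : 0 ≤ ε := (abs_nonneg _).trans (hc m le_rfl)
  have hlim := ((tendsto_kakeyaApprox hs x a).sub_const (kakeyaApprox c x m a)).abs
  refine le_of_tendsto hlim (eventually_atTop.2 ⟨m, fun N hN => ?_⟩)
  refine (abs_kakeyaApprox_sub_le hN (fun n hn _ => hc n hn) a).trans ?_
  exact mul_le_mul_of_nonneg_left
    (by linarith [dyadicFloor_le N a, sub_dyadicFloor_le m a]) hε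

theorem abs_kakeyaIntercept_le {c : ℕ → ℝ} {s : ℝ} (hs : ∀ n, |c n| ≤ s) (a : ℝ) :
    |kakeyaIntercept c a| ≤ s := by
  simpa [kakeyaApprox] using
    abs_sub_kakeyaApprox_le (x := 0) hs 0 (fun n _ => by simpa using hs n) a

/-- Over each abscissa near which the pivots stay for `L` consecutive digits, the `h`-neighbourhood
of the line family has small measure. -/
theorem volume_kakeya_section_le {c : ℕ → ℝ} {s x ε : ℝ} (hs : ∀ n, |c n| ≤ s) (hx : |x| ≤ s)
    {m L : ℕ} (hc : ∀ n, m ≤ n → n < m + L → |x - c n| ≤ ε) (hε : 0 ≤ ε) :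
    volume {y : ℝ | ∃ a ∈ Icc (-1 : ℝ) 1, |y - (a * x + kakeyaIntercept c a)| < (1 / 2) ^ (m + L)}
      ≤ ENNReal.ofReal (6 * (ε + (2 * s + 1) * (1 / 2) ^ L)) := by
  have hs0 : 0 ≤ s := (abs_nonneg _).trans hx
  set R : ℝ := (1 / 2) ^ m * (ε + (2 * s + 1) * (1 / 2) ^ L) with hR
  have hsub : {y : ℝ | ∃ a ∈ Icc (-1 : ℝ) 1,
      |y - (a * x + kakeyaIntercept c a)| < (1 / 2) ^ (m + L)} ⊆
      ⋃ i ∈ Finset.Icc (-2 ^ m : ℤ) (2 ^ m),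
        Metric.closedBall (kakeyaApprox c x m ((i : ℝ) / 2 ^ m)) R := by
    rintro y ⟨a, ha, hy⟩
    have h2 : (0 : ℝ) < 2 ^ m := by positivity
    simp only [mem_iUnion, exists_prop]
    refine ⟨⌊a * 2 ^ m⌋, Finset.mem_Icc.2 ⟨Int.le_floor.2 ?_, ?_⟩, ?_⟩
    · push_cast
      nlinarith [ha.1]
    · refine Int.floor_le_iff.2 ?_
      push_cast
      nlinarith [ha.2]
    · change _ ∈ Metric.closedBall (kakeyaApprox c x m (dyadicFloor m a)) R
      rw [kakeyaApprox_dyadicFloor, Metric.mem_closedBall, Real.dist_eq]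
      -- Past the block only the crude bound `|x - c n| ≤ 2 * s` is available, but those digits
      -- contribute at most `(1 / 2) ^ (m + L)` to the slope.
      have h1 := abs_sub_kakeyaApprox_le (x := x) (ε := 2 * s) hs (m + L)
        (fun n _ => (abs_sub _ _).trans (by linarith [hs n])) a
      have h3 := abs_kakeyaApprox_sub_le (Nat.le_add_right m L) hc a
      have h4 : ε * (dyadicFloor (m + L) a - dyadicFloor m a) ≤ ε * (1 / 2) ^ m :=
        mul_le_mul_of_nonneg_left
          (by linarith [dyadicFloor_le (m + L) a, sub_dyadicFloor_le m a]) hε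
      have h5 := abs_sub_le y (a * x + kakeyaIntercept c a) (kakeyaApprox c x m a)
      have h6 := abs_sub_le (a * x + kakeyaIntercept c a) (kakeyaApprox c x (m + L) a)
        (kakeyaApprox c x m a)
      have h7 : R = ε * (1 / 2) ^ m + 2 * s * (1 / 2) ^ (m + L) + (1 / 2) ^ (m + L) := by
        rw [hR, pow_add]; ring
      linarith
  refine (measure_mono hsub).trans ((measure_biUnion_finset_le _ _).trans ?_)
  simp only [Real.volume_closedBall, Finset.sum_const, Int.card_Icc, nsmul_eq_mul]
  rw [← ENNReal.ofReal_natCast, ← ENNReal.ofReal_mul (by positivity)]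
  refine ENNReal.ofReal_le_ofReal ?_
  have hcard : (((2 ^ m + 1 - -2 ^ m : ℤ).toNat : ℕ) : ℝ) ≤ 3 * 2 ^ m := by
    have h1 : (((2 ^ m + 1 - -2 ^ m : ℤ).toNat : ℤ)) ≤ 3 * 2 ^ m := by
      have : (1 : ℤ) ≤ 2 ^ m := one_le_pow₀ (by norm_num)
      omega
    exact_mod_cast h1
  have hR0 : 0 ≤ R := by positivity
  calc _ ≤ 3 * 2 ^ m * (2 * R) := mul_le_mul_of_nonneg_right hcard (by positivity)
    _ = 6 * (2 ^ m * (1 / 2) ^ m) * (ε + (2 * s + 1) * (1 / 2) ^ L) := by rw [hR]; ring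
    _ = _ := by rw [← mul_pow]; norm_num

/-- The sequence `s * sin √n` stays near every point of `[-s, s]` for arbitrarily long blocks. -/
theorem exists_block_abs_sub_mul_sin_sqrt_le {s x ε : ℝ} (hs : 0 < s) (hx : |x| ≤ s) (hε : 0 < ε)
    (L : ℕ) : ∃ m : ℕ, ∀ n : ℕ, m ≤ n → n < m + L → |x - s * Real.sin √n| ≤ ε := by
  -- Solving `s * sin t = x` with `t` far out makes `√n` vary by at most `(L + 1) / t` over the
  -- block starting at `⌈t ^ 2⌉₊`.
  obtain ⟨k, hk⟩ := exists_nat_ge (max 1 (s * (L + 1) / ε) + 2)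
  set t := Real.arcsin (x / s) + k * (2 * Real.pi) with ht
  have hpi := Real.pi_gt_three
  have ht1 : max 1 (s * (L + 1) / ε) ≤ t := by
    have h1 := Real.neg_pi_div_two_le_arcsin (x / s)
    have h2 : (0 : ℝ) ≤ k - 2 := by linarith [le_max_left 1 (s * (L + 1) / ε)]
    nlinarith
  have ht0 : 0 < t := by linarith [le_max_left 1 (s * (L + 1) / ε)]
  have hxt : x = s * Real.sin t := by
    rw [ht, Real.sin_add_nat_mul_two_pi, Real.sin_arcsin]
    · field_simp
    · rw [le_div_iff₀ hs]; linarith [(abs_le.1 hx).1]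
    · rw [div_le_iff₀ hs]; linarith [(abs_le.1 hx).2]
  refine ⟨⌈t ^ 2⌉₊, fun n hn hnL => ?_⟩
  have h1 : t ^ 2 ≤ n := (Nat.le_ceil _).trans (by exact_mod_cast hn)
  have h2 : (n : ℝ) ≤ t ^ 2 + 1 + L := by
    have h3 := Nat.ceil_lt_add_one (sq_nonneg t)
    have h4 : (n : ℝ) < (⌈t ^ 2⌉₊ : ℝ) + L := by exact_mod_cast hnL
    linarith
  have h5 : t ≤ √n := Real.le_sqrt_of_sq_le h1
  have h6 : √n - t ≤ (L + 1) / t := by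
    rw [le_div_iff₀ ht0]
    nlinarith [Real.sq_sqrt (Nat.cast_nonneg (α := ℝ) n)]
  have h7 : s * ((L + 1) / t) ≤ ε := by
    have := (le_max_right _ _).trans ht1
    rw [div_le_iff₀ hε] at this
    rw [mul_div_assoc', div_le_iff₀ ht0]
    linarith
  calc |x - s * Real.sin √n| = s * |Real.sin t - Real.sin √n| := by
        rw [hxt, ← mul_sub, abs_mul, abs_of_pos hs]
    _ ≤ s * |t - √n| :=
        mul_le_mul_of_nonneg_left (Real.abs_sin_sub_sin_le _ _) hs.le
    _ = s * (√n - t) := by rw [abs_sub_comm, abs_of_nonneg (sub_nonneg.2 h5)]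
    _ ≤ s * ((L + 1) / t) := by gcongr
    _ ≤ ε := h7

/-! ### Neighbourhoods of the family and oscillating densities -/

/-- The `h`-neighbourhood (in vertical direction) of the lines `y = a x + b a`, `|a| ≤ 1`,
over the abscissae `|x| ≤ s`. -/
def lineFamilyNhd (s : ℝ) (b : ℝ → ℝ) (h : ℝ) : Set (ℝ × ℝ) :=
  {p | |p.1| ≤ s ∧ ∃ a ∈ Icc (-1 : ℝ) 1, |p.2 - (a * p.1 + b a)| < h}

theorem measurableSet_lineFamilyNhd (s : ℝ) (b : ℝ → ℝ) (h : ℝ) :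
    MeasurableSet (lineFamilyNhd s b h) := by
  have h1 : IsClosed {p : ℝ × ℝ | |p.1| ≤ s} := isClosed_le (by fun_prop) continuous_const
  have h2 : IsOpen {p : ℝ × ℝ | ∃ a ∈ Icc (-1 : ℝ) 1, |p.2 - (a * p.1 + b a)| < h} := by
    have : {p : ℝ × ℝ | ∃ a ∈ Icc (-1 : ℝ) 1, |p.2 - (a * p.1 + b a)| < h}
        = ⋃ a ∈ Icc (-1 : ℝ) 1, {p | |p.2 - (a * p.1 + b a)| < h} := by
      ext p; simp
    rw [this]
    exact isOpen_biUnion fun a _ => isOpen_lt (by fun_prop) continuous_const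
  exact h1.measurableSet.inter h2.measurableSet

theorem lineFamilyNhd_mono (s : ℝ) (b : ℝ → ℝ) : Monotone (lineFamilyNhd s b) :=
  fun _ _ hh _ ⟨hp, a, ha, hpa⟩ => ⟨hp, a, ha, hpa.trans_le hh⟩

theorem lineFamilyNhd_subset {s h : ℝ} {b : ℝ → ℝ} (hb : ∀ a, |b a| ≤ s) :
    lineFamilyNhd s b h ⊆ Icc (-s) s ×ˢ Icc (-(2 * s + h)) (2 * s + h) := by
  rintro p ⟨hp, a, ha, hpa⟩
  refine ⟨abs_le.1 hp, abs_le.1 ?_⟩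
  have h1 : |a * p.1| ≤ 1 * s := by
    rw [abs_mul]
    exact mul_le_mul (abs_le.2 ha) hp (abs_nonneg _) zero_le_one
  have h2 := abs_add_le (a * p.1) (b a)
  have h3 := abs_add_le (p.2 - (a * p.1 + b a)) (a * p.1 + b a)
  rw [sub_add_cancel] at h3
  linarith [hb a]

/-- There are compressible line families containing a line of each slope in `[-1, 1]`. -/
theorem exists_intercept_volume_lineFamilyNhd_le {s : ℝ} (hs : 0 < s) :
    ∃ b : ℝ → ℝ, (∀ a, |b a| ≤ s) ∧
      ∀ δ : ℝ≥0∞, 0 < δ → ∃ h : ℝ, 0 < h ∧ volume (lineFamilyNhd s b h) ≤ δ := by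
  set c : ℕ → ℝ := fun n => s * Real.sin √n with hc
  have hcs : ∀ n, |c n| ≤ s := fun n => by
    rw [hc, abs_mul, abs_of_pos hs]
    exact mul_le_of_le_one_right hs.le (Real.abs_sin_le_one _)
  have hb := abs_kakeyaIntercept_le hcs
  refine ⟨kakeyaIntercept c, hb, fun δ hδ => ?_⟩
  set S : ℕ → Set (ℝ × ℝ) := fun n => lineFamilyNhd s (kakeyaIntercept c) ((1 / 2) ^ n) with hS
  have hSm : ∀ n, MeasurableSet (S n) := fun n => measurableSet_lineFamilyNhd _ _ _
  have hSa : Antitone S := fun m n hmn => lineFamilyNhd_mono _ _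
    (pow_le_pow_of_le_one (by norm_num) (by norm_num) hmn)
  have hS0 : volume (S 0) ≠ ∞ := by
    refine ((measure_mono (lineFamilyNhd_subset hb)).trans_lt ?_).ne
    exact (isCompact_Icc.prod isCompact_Icc).measure_lt_top
  have hnull : volume (⋂ n, S n) = 0 := by
    rw [Measure.volume_eq_prod, Measure.measure_prod_null (MeasurableSet.iInter hSm)]
    refine ae_of_all _ fun x => ?_
    by_cases hx : |x| ≤ s
    · change volume _ = 0
      have hlim : Tendsto (fun L : ℕ => ENNReal.ofReal
          (6 * ((1 / 2) ^ L + (2 * s + 1) * (1 / 2) ^ L))) atTop (𝓝 0) := by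
        have h0 : Tendsto (fun L : ℕ => (1 / 2 : ℝ) ^ L) atTop (𝓝 0) :=
          tendsto_pow_atTop_nhds_zero_of_lt_one (by norm_num) (by norm_num)
        have h1 := ENNReal.tendsto_ofReal ((h0.add (h0.const_mul (2 * s + 1))).const_mul 6)
        simpa using h1
      refine le_antisymm (ge_of_tendsto' hlim fun L => ?_) zero_le
      -- For every `L` some block of `L` pivots stays within `(1 / 2) ^ L` of `x`, so the section is
      -- null.
      obtain ⟨m, hm⟩ := exists_block_abs_sub_mul_sin_sqrt_le hs hx
        (show (0 : ℝ) < (1 / 2) ^ L by positivity) L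
      refine (measure_mono ?_).trans (volume_kakeya_section_le hcs hx hm (by positivity))
      intro y hy
      exact (mem_iInter.1 hy (m + L)).2
    · have hempty : Prod.mk x ⁻¹' (⋂ n, S n) = ∅ :=
        eq_empty_of_forall_notMem fun y hy => hx (mem_iInter.1 hy 0).1
      change volume (Prod.mk x ⁻¹' (⋂ n, S n)) = 0
      rw [hempty, measure_empty]
  have hlim := tendsto_measure_iInter_atTop (fun n => (hSm n).nullMeasurableSet) hSa ⟨0, hS0⟩
  rw [hnull] at hlim
  obtain ⟨n, hn⟩ := (hlim.eventually_lt_const hδ).exists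
  exact ⟨(1 / 2) ^ n, by positivity, hn.le⟩

theorem measurableSet_strip (a b h : ℝ) :
    MeasurableSet {p : ℝ × ℝ | |p.2 - (a * p.1 + b)| < h} :=
  (isOpen_lt (by fun_prop) continuous_const).measurableSet

theorem volume_strip_inter_slab (x₀ a b : ℝ) {s : ℝ} (hs : 0 ≤ s) (h : ℝ) :
    volume {p : ℝ × ℝ | |p.1 - x₀| ≤ s ∧ |p.2 - (a * p.1 + b)| < h}
      = ENNReal.ofReal (4 * s * h) := by
  have h1 : IsClosed {p : ℝ × ℝ | |p.1 - x₀| ≤ s} := isClosed_le (by fun_prop) continuous_const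
  rw [Measure.volume_eq_prod,
    Measure.prod_apply (show MeasurableSet {p : ℝ × ℝ | |p.1 - x₀| ≤ s ∧ |p.2 - (a * p.1 + b)| < h}
      from h1.measurableSet.inter (measurableSet_strip a b h))]
  have h2 : ∀ x, volume (Prod.mk x ⁻¹'
      {p : ℝ × ℝ | |p.1 - x₀| ≤ s ∧ |p.2 - (a * p.1 + b)| < h})
      = (Metric.closedBall x₀ s).indicator (fun _ => ENNReal.ofReal (2 * h)) x := by
    intro x
    by_cases hx : |x - x₀| ≤ s
    · rw [indicator_of_mem (by simpa [Real.dist_eq] using hx), ← Real.volume_ball (a * x + b)]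
      congr 1
      ext y
      simp [hx, Real.dist_eq]
    · rw [indicator_of_notMem (by simpa [Real.dist_eq] using hx)]
      simp [hx]
  simp only [h2]
  rw [lintegral_indicator Metric.isClosed_closedBall.measurableSet, setLIntegral_const,
    Real.volume_closedBall, mul_comm, ← ENNReal.ofReal_mul (by positivity)]
  congr 1
  ring

/-- A bounded set in the plane whose densities along strips around a line of each slope in
`[-1, 1]` oscillate as the width tends to zero. -/
theorem exists_oscillating_strip_density {s : ℝ} (hs : 0 < s) :
    ∃ T : Set (ℝ × ℝ), MeasurableSet T ∧ T ⊆ Icc (-s) s ×ˢ Icc (-(3 * s)) (3 * s) ∧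
      ∀ a ∈ Icc (-1 : ℝ) 1, ∃ b, |b| ≤ s ∧
        (∃ᶠ h in 𝓝[>] (0 : ℝ),
          ENNReal.ofReal (3 * s * h) ≤ volume (T ∩ {p | |p.2 - (a * p.1 + b)| < h})) ∧
        (∃ᶠ h in 𝓝[>] (0 : ℝ),
          volume (T ∩ {p | |p.2 - (a * p.1 + b)| < h}) ≤ ENNReal.ofReal (s * h)) := by
  obtain ⟨b, hb, hsmall⟩ := exists_intercept_volume_lineFamilyNhd_le hs
  set S := lineFamilyNhd s b with hS
  have hSmono : Monotone S := lineFamilyNhd_mono s b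
  have hstep : ∀ h : ℝ, 0 < h → ∃ h', 0 < h' ∧ h' ≤ h / 2 ∧
      volume (S h') ≤ ENNReal.ofReal (s * h) := by
    intro h hh
    obtain ⟨h', h0, hv⟩ := hsmall (ENNReal.ofReal (s * h)) (ENNReal.ofReal_pos.2 (by positivity))
    exact ⟨min h' (h / 2), lt_min h0 (by positivity), min_le_right _ _,
      (measure_mono (hSmono (min_le_left _ _))).trans hv⟩
  choose! φ hφ0 hφ2 hφv using hstep
  -- Starting at `s` keeps the set within height `2 * s + u 0 = 3 * s`.
  set u : ℕ → ℝ := fun n => φ^[n] s with hu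
  have hus : ∀ n, u (n + 1) = φ (u n) := fun n => Function.iterate_succ_apply' _ _ _
  have hu0 : ∀ n, 0 < u n := by
    intro n
    induction n with
    | zero => exact hs
    | succ n ih => rw [hus]; exact hφ0 _ ih
  have hanti : Antitone u := antitone_nat_of_succ_le fun n => by
    rw [hus]; linarith [hφ2 _ (hu0 n), hu0 n]
  have huv : ∀ n, volume (S (u (n + 1))) ≤ ENNReal.ofReal (s * u n) := fun n => by
    rw [hus]; exact hφv _ (hu0 n)
  have hule : ∀ n, u n ≤ s * (1 / 2) ^ n := by
    intro n
    induction n with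
    | zero => simp [hu]
    | succ n ih => rw [hus, pow_succ]; linarith [hφ2 _ (hu0 n)]
  have hulim : Tendsto u atTop (𝓝[>] 0) := by
    refine tendsto_nhdsWithin_iff.2 ⟨?_, Eventually.of_forall hu0⟩
    have h0 : Tendsto (fun n : ℕ => s * (1 / 2 : ℝ) ^ n) atTop (𝓝 (s * 0)) :=
      (tendsto_pow_atTop_nhds_zero_of_lt_one (by norm_num) (by norm_num)).const_mul s
    rw [mul_zero] at h0
    exact squeeze_zero (fun n => (hu0 n).le) hule h0
  have hSm : ∀ n, MeasurableSet (S (u n)) := fun n => measurableSet_lineFamilyNhd _ _ _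
  have hstrip : ∀ a ∈ Icc (-1 : ℝ) 1, ∀ h,
      {p : ℝ × ℝ | |p.1| ≤ s ∧ |p.2 - (a * p.1 + b a)| < h} ⊆ S h :=
    fun a ha h p hp => ⟨hp.1, a, ha, hp.2⟩
  refine ⟨⋃ k, S (u (2 * k)) \ S (u (2 * k + 1)),
    MeasurableSet.iUnion fun k => (hSm _).diff (hSm _), ?_, fun a ha => ⟨b a, hb a, ?_, ?_⟩⟩
  · refine iUnion_subset fun k => sdiff_subset.trans ((hSmono (hanti (Nat.zero_le _))).trans ?_)
    have h3 : 2 * s + u 0 = 3 * s := by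
      change 2 * s + s = _
      ring
    rw [← h3]
    exact lineFamilyNhd_subset hb
  · have hsub : Tendsto (fun k : ℕ => u (2 * k)) atTop (𝓝[>] 0) :=
      hulim.comp (tendsto_id.const_mul_atTop' two_pos)
    refine hsub.frequently (Eventually.frequently (Eventually.of_forall fun k => ?_))
    have h4 := volume_strip_inter_slab 0 a (b a) hs.le (u (2 * k))
    simp only [sub_zero] at h4
    calc ENNReal.ofReal (3 * s * u (2 * k))
        = ENNReal.ofReal (4 * s * u (2 * k)) - ENNReal.ofReal (s * u (2 * k)) := by
          rw [← ENNReal.ofReal_sub _ (mul_pos hs (hu0 _)).le]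
          congr 1
          ring
      _ ≤ volume {p : ℝ × ℝ | |p.1| ≤ s ∧ |p.2 - (a * p.1 + b a)| < u (2 * k)}
          - volume (S (u (2 * k + 1))) := by
          rw [h4]
          exact tsub_le_tsub_left (huv _) _
      _ ≤ volume ({p : ℝ × ℝ | |p.1| ≤ s ∧ |p.2 - (a * p.1 + b a)| < u (2 * k)}
          \ S (u (2 * k + 1))) := le_measure_sdiff
      _ ≤ _ := by
          refine measure_mono fun p hp => ?_
          exact ⟨mem_iUnion.2 ⟨k, hstrip a ha _ hp.1, hp.2⟩, hp.1.2⟩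
  · have hsub : Tendsto (fun k : ℕ => u (2 * k + 1)) atTop (𝓝[>] 0) :=
      hulim.comp (tendsto_add_atTop_nat 1 |>.comp (tendsto_id.const_mul_atTop' two_pos))
    refine hsub.frequently (Eventually.frequently (Eventually.of_forall fun k => ?_))
    refine (measure_mono ?_).trans (huv (2 * k + 1))
    rintro p ⟨hpT, hp⟩
    obtain ⟨j, hj, hj'⟩ := mem_iUnion.1 hpT
    have hpS : p ∈ S (u (2 * k + 1)) := hstrip a ha _ ⟨hj.1, hp⟩
    -- For `j ≤ k`, the removed `S (u (2 * j + 1))` contains `S (u (2 * k + 1))`, hence `p`.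
    have hkj : k < j := by
      by_contra! hle
      exact hj' (hSmono (hanti (by omega)) hpS)
    exact hSmono (hanti (by omega)) hj

/-- A bounded planar set whose strip densities oscillate around some line in each direction. -/
theorem exists_oscillating_strip_density_all_directions :
    ∃ K : Set (ℝ × ℝ), MeasurableSet K ∧ Bornology.IsBounded K ∧ ∀ a ∈ Icc (-1 : ℝ) 1,
      (∃ b α β : ℝ, 0 ≤ α ∧ α < β ∧
        (∃ᶠ h in 𝓝[>] (0 : ℝ),
          ENNReal.ofReal (β * h) ≤ volume (K ∩ {p | |p.2 - (a * p.1 + b)| < h})) ∧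
        (∃ᶠ h in 𝓝[>] (0 : ℝ),
          volume (K ∩ {p | |p.2 - (a * p.1 + b)| < h}) ≤ ENNReal.ofReal (α * h))) ∧
      (∃ b α β : ℝ, 0 ≤ α ∧ α < β ∧
        (∃ᶠ h in 𝓝[>] (0 : ℝ),
          ENNReal.ofReal (β * h) ≤ volume (K ∩ {p | |p.1 - (a * p.2 + b)| < h})) ∧
        (∃ᶠ h in 𝓝[>] (0 : ℝ),
          volume (K ∩ {p | |p.1 - (a * p.2 + b)| < h}) ≤ ENNReal.ofReal (α * h))) := by
  obtain ⟨T₁, hm₁, hsub₁, h₁⟩ := exists_oscillating_strip_density one_pos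
  obtain ⟨T₂, hm₂, hsub₂, h₂⟩ :=
    -- The second copy is small, so it cannot spoil the oscillation of the first, and it is moved 10
    -- units away, so its own thin strips miss the first.
    exists_oscillating_strip_density (show (0 : ℝ) < 1 / 12 by norm_num)
  have hψ : MeasurePreserving (fun p : ℝ × ℝ => (p.2, p.1 - 10)) := by
    have h1 : MeasurePreserving (fun x : ℝ => x - 10) := measurePreserving_sub_right volume 10
    have h2 := ((MeasurePreserving.id (volume : Measure ℝ)).prod h1).comp
      (Measure.measurePreserving_swap (μ := (volume : Measure ℝ)) (ν := (volume : Measure ℝ)))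
    exact h2
  set U : Set (ℝ × ℝ) := (fun p : ℝ × ℝ => (p.2, p.1 - 10)) ⁻¹' T₂ with hU
  have hUsub : U ⊆ Icc 9 11 ×ˢ Icc (-1) 1 := by
    intro p hp
    obtain ⟨⟨h1, h2⟩, h3, h4⟩ := hsub₂ hp
    simp only at h1 h2 h3 h4
    exact ⟨⟨by linarith, by linarith⟩, ⟨by linarith, by linarith⟩⟩
  refine ⟨T₁ ∪ U, hm₁.union (hψ.measurable hm₂), ?_, fun a ha => ⟨?_, ?_⟩⟩
  · refine Bornology.IsBounded.union (Bornology.IsBounded.subset ?_ hsub₁)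
      (Bornology.IsBounded.subset ?_ hUsub) <;>
    exact (Metric.isBounded_Icc _ _).prod (Metric.isBounded_Icc _ _)
  · obtain ⟨b, -, hβ, hα⟩ := h₁ a ha
    -- The second copy has horizontal extent at most `1 / 2`, adding at most `h`: the upper bound
    -- `h` becomes `2 * h`, still below `3 * h`.
    refine ⟨b, 2, 3, by norm_num, by norm_num, ?_, ?_⟩
    · refine hβ.mono fun h hh => ?_
      rw [mul_one] at hh
      exact hh.trans (measure_mono (inter_subset_inter_left _ subset_union_left))
    · refine (hα.and_eventually self_mem_nhdsWithin).mono fun h ⟨hh, h0⟩ => ?_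
      have h0 : 0 < h := h0
      have hV : volume (U ∩ {p : ℝ × ℝ | |p.2 - (a * p.1 + b)| < h}) ≤ ENNReal.ofReal h := by
        have h3 := volume_strip_inter_slab 10 a b (show (0 : ℝ) ≤ 1 / 4 by norm_num) h
        rw [show 4 * (1 / 4) * h = h by ring] at h3
        rw [← h3]
        refine measure_mono fun p hp => ⟨abs_le.2 ?_, hp.2⟩
        obtain ⟨-, h4, h5⟩ := hsub₂ hp.1
        simp only at h4 h5
        exact ⟨by linarith, by linarith⟩
      rw [union_inter_distrib_right]
      refine (measure_union_le _ _).trans ((add_le_add hh hV).trans ?_)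
      rw [← ENNReal.ofReal_add (by positivity) h0.le]
      exact ENNReal.ofReal_le_ofReal (by linarith)
  · obtain ⟨b, hb, hβ, hα⟩ := h₂ a ha
    refine ⟨10 + b, 1 / 12, 3 * (1 / 12), by norm_num, by norm_num, ?_, ?_⟩
    all_goals
      have key : ∀ h : ℝ, U ∩ {p : ℝ × ℝ | |p.1 - (a * p.2 + (10 + b))| < h}
          = (fun p : ℝ × ℝ => (p.2, p.1 - 10)) ⁻¹'
            (T₂ ∩ {p | |p.2 - (a * p.1 + b)| < h}) := by
        intro h
        ext p
        simp only [hU, mem_inter_iff, mem_preimage, mem_ofPred_eq]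
        rw [show p.1 - 10 - (a * p.2 + b) = p.1 - (a * p.2 + (10 + b)) by ring]
      have hvol : ∀ h : ℝ, volume (U ∩ {p : ℝ × ℝ | |p.1 - (a * p.2 + (10 + b))| < h})
          = volume (T₂ ∩ {p | |p.2 - (a * p.1 + b)| < h}) := fun h => by
        rw [key, hψ.measure_preimage (hm₂.inter (measurableSet_strip a b h)).nullMeasurableSet]
    · refine hβ.mono fun h hh => ?_
      rw [← hvol] at hh
      exact hh.trans (measure_mono (inter_subset_inter_left _ subset_union_right))
    · refine (hα.and_eventually (Ioo_mem_nhdsGT one_pos)).mono fun h ⟨hh, h0⟩ => ?_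
      rw [← hvol] at hh
      refine (measure_mono ?_).trans hh
      rintro p ⟨hp | hp, hps⟩
      · exfalso
        obtain ⟨⟨h3, h4⟩, h5, h6⟩ := hsub₁ hp
        have h7 : |a * p.2| ≤ 1 * 3 := by
          rw [abs_mul]
          exact mul_le_mul (abs_le.2 ha) (abs_le.2 ⟨by linarith, by linarith⟩) (abs_nonneg _)
            zero_le_one
        have h8 := (abs_lt.1 (mem_ofPred_eq ▸ hps)).1
        linarith [(abs_le.1 h7).1, (abs_le.1 hb).1, h0.2]
      · exact ⟨hp, hps⟩

/-! ### Transfer to the Euclidean plane -/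

theorem radonTransform_not_ae_eq_continuous {K : Set (EuclideanSpace ℝ (Fin 2))}
    (hK : MeasurableSet K) {θ : EuclideanSpace ℝ (Fin 2)} (hθ : ‖θ‖ = 1) {q r₀ α β : ℝ}
    (hq : 0 < q) (hα0 : 0 ≤ α) (hαβ : α < β)
    (hβ : ∃ᶠ h in 𝓝[>] (0 : ℝ),
      ENNReal.ofReal (β * h) ≤ volume (K ∩ {x | |⟪x, θ⟫ - r₀| < q * h}))
    (hα : ∃ᶠ h in 𝓝[>] (0 : ℝ),
      volume (K ∩ {x | |⟪x, θ⟫ - r₀| < q * h}) ≤ ENNReal.ofReal (α * h)) :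
    ¬ ∃ g : ℝ → ℝ≥0∞, Continuous g ∧ radonTransform K θ =ᵐ[volume] g := by
  have hlim : Tendsto (fun h => q * h) (𝓝[>] 0) (𝓝[>] 0) := by
    refine tendsto_nhdsWithin_iff.2 ⟨?_, ?_⟩
    · have : Tendsto (fun h : ℝ => q * h) (𝓝 0) (𝓝 (q * 0)) := by
        exact (continuous_const.mul continuous_id).tendsto 0
      rw [mul_zero] at this
      exact this.mono_left nhdsWithin_le_nhds
    · filter_upwards [self_mem_nhdsWithin] with h hh using mul_pos hq hh
  -- The ball of radius `q * h` has length `2 * q * h`, hence the thresholds `α / (2 * q)` and `β /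
  -- (2 * q)`.
  have hball : ∀ γ h : ℝ, 0 ≤ γ →
      ENNReal.ofReal (γ / (2 * q)) * volume (Metric.ball r₀ (q * h)) = ENNReal.ofReal (γ * h) := by
    intro γ h hγ
    rw [Real.volume_ball, ← ENNReal.ofReal_mul (by positivity)]
    congr 1
    field_simp
  refine not_ae_eq_continuous_of_average_oscillation (r₀ := r₀)
    (α := ENNReal.ofReal (α / (2 * q))) (β := ENNReal.ofReal (β / (2 * q))) ?_
    (hlim.frequently (hβ.mono fun h hh => ?_)) (hlim.frequently (hα.mono fun h hh => ?_))
  · exact (ENNReal.ofReal_lt_ofReal_iff (by have := hα0.trans_lt hαβ; positivity)).2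
      (div_lt_div_of_pos_right hαβ (by positivity))
  · rwa [hball _ _ (hα0.trans hαβ.le), lintegral_radonTransform_ball hK hθ]
  · rwa [hball _ _ hα0, lintegral_radonTransform_ball hK hθ]

theorem measurePreserving_euclideanPlane_prod :
    MeasurePreserving fun x : EuclideanSpace ℝ (Fin 2) => (x 0, x 1) :=
  (volume_preserving_finTwoArrow ℝ).comp (PiLp.volume_preserving_ofLp (Fin 2))

theorem isBounded_preimage_euclideanPlane_prod {K : Set (ℝ × ℝ)} (hK : Bornology.IsBounded K) :
    Bornology.IsBounded ((fun x : EuclideanSpace ℝ (Fin 2) => (x 0, x 1)) ⁻¹' K) := by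
  obtain ⟨C, hC⟩ := isBounded_iff_forall_norm_le.1 hK
  refine isBounded_iff_forall_norm_le.2 ⟨√(C ^ 2 + C ^ 2), fun x hx => ?_⟩
  have h := norm_prod_le_iff.1 (hC _ hx)
  rw [EuclideanSpace.norm_eq, Fin.sum_univ_two]
  exact Real.sqrt_le_sqrt (add_le_add (pow_le_pow_left₀ (norm_nonneg _) h.1 2)
    (pow_le_pow_left₀ (norm_nonneg _) h.2 2))

theorem exists_radonTransform_not_ae_eq_continuous :
    ∃ K : Set (EuclideanSpace ℝ (Fin 2)), Bornology.IsBounded K ∧ MeasurableSet K ∧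
      ∀ θ : EuclideanSpace ℝ (Fin 2), ‖θ‖ = 1 →
        ¬ ∃ g : ℝ → ℝ≥0∞, Continuous g ∧ radonTransform K θ =ᵐ[volume] g := by
  obtain ⟨K, hK, hKb, hosc⟩ := exists_oscillating_strip_density_all_directions
  have he := measurePreserving_euclideanPlane_prod
  refine ⟨_, isBounded_preimage_euclideanPlane_prod hKb, he.measurable hK, fun θ hθ => ?_⟩
  have hinner : ∀ x : EuclideanSpace ℝ (Fin 2), ⟪x, θ⟫ = x 0 * θ 0 + x 1 * θ 1 := fun x => by
    simp [PiLp.inner_apply, Fin.sum_univ_two, mul_comm]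
  have hne : θ 0 ≠ 0 ∨ θ 1 ≠ 0 := by
    by_contra! h
    have : ‖θ‖ = 0 := by simp [EuclideanSpace.norm_eq, Fin.sum_univ_two, h.1, h.2]
    linarith
  have hslope : ∀ u v : ℝ, v ≠ 0 → |u| ≤ |v| → -u / v ∈ Icc (-1 : ℝ) 1 := fun u v hv h => by
    rw [mem_Icc, ← abs_le, abs_div, abs_neg]
    exact div_le_one_of_le₀ h (abs_nonneg _)
  have hiff : ∀ u v b h y z : ℝ, v ≠ 0 →
      (|y - (-u / v * z + b)| < h ↔ |z * u + y * v - b * v| < |v| * h) := by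
    intro u v b h y z hv
    have : z * u + y * v - b * v = v * (y - (-u / v * z + b)) := by field_simp; ring
    rw [this, abs_mul, mul_lt_mul_iff_right₀ (abs_pos.2 hv)]
  -- Dividing by the larger coordinate of `θ` puts the slope in `[-1, 1]`; that coordinate's
  -- absolute value is the scale `q`.
  rcases le_total |θ 0| |θ 1| with h | h
  · have h1 : θ 1 ≠ 0 := fun h0 => by simp_all
    obtain ⟨b, α, β, hα0, hαβ, hβ, hα⟩ := (hosc _ (hslope _ _ h1 h)).1
    have key : ∀ h : ℝ, volume (((fun x : EuclideanSpace ℝ (Fin 2) => (x 0, x 1)) ⁻¹' K) ∩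
        {x | |⟪x, θ⟫ - b * θ 1| < |θ 1| * h})
        = volume (K ∩ {p | |p.2 - (-θ 0 / θ 1 * p.1 + b)| < h}) := fun h => by
      rw [← he.measure_preimage (hK.inter (measurableSet_strip _ _ _)).nullMeasurableSet]
      congr 1
      ext x
      simp [hinner, hiff _ _ _ _ _ _ h1]
    simp only [← key] at hβ hα
    exact radonTransform_not_ae_eq_continuous (he.measurable hK) hθ (abs_pos.2 h1) hα0 hαβ hβ hα
  · have h1 : θ 0 ≠ 0 := fun h0 => by simp_all
    obtain ⟨b, α, β, hα0, hαβ, hβ, hα⟩ := (hosc _ (hslope _ _ h1 h)).2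
    have key : ∀ h : ℝ, volume (((fun x : EuclideanSpace ℝ (Fin 2) => (x 0, x 1)) ⁻¹' K) ∩
        {x | |⟪x, θ⟫ - b * θ 0| < |θ 0| * h})
        = volume (K ∩ {p | |p.1 - (-θ 1 / θ 0 * p.2 + b)| < h}) := fun h => by
      have hm : MeasurableSet {p : ℝ × ℝ | |p.1 - (-θ 1 / θ 0 * p.2 + b)| < h} :=
        measurable_swap (measurableSet_strip (-θ 1 / θ 0) b h)
      rw [← he.measure_preimage (hK.inter hm).nullMeasurableSet]
      congr 1
      ext x
      simp [hinner, hiff _ _ _ _ _ _ h1, add_comm (x 0 * θ 0)]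
    simp only [← key] at hβ hα
    exact radonTransform_not_ae_eq_continuous (he.measurable hK) hθ (abs_pos.2 h1) hα0 hαβ hβ hα

theorem continuous_of_absolutelyContinuousOnInterval {g : ℝ → ℝ}
    (hg : ∀ a b : ℝ, AbsolutelyContinuousOnInterval g a b) : Continuous g :=
  continuous_iff_continuousAt.2 fun x => (hg (x - 1) (x + 1)).continuousOn.continuousAt <| by
    rw [uIcc_of_le (by linarith)]
    exact Icc_mem_nhds (by linarith) (by linarith)

theorem mainTheorem12 :
    ∃ K : Set (EuclideanSpace ℝ (Fin 2)),
      Bornology.IsBounded K ∧ MeasurableSet K ∧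
      ∀ θ : EuclideanSpace ℝ (Fin 2), ‖θ‖ = 1 →
        (¬ ∃ g : ℝ → ℝ≥0∞, Continuous g ∧ radonTransform K θ =ᵐ[volume] g) ∧
        (¬ ∃ g : ℝ → ℝ, (∀ a b : ℝ, AbsolutelyContinuousOnInterval g a b) ∧
          radonTransform K θ =ᵐ[volume] fun r => ENNReal.ofReal (g r)) := by
  obtain ⟨K, hKb, hK, h⟩ := exists_radonTransform_not_ae_eq_continuous
  refine ⟨K, hKb, hK, fun θ hθ => ⟨h θ hθ, ?_⟩⟩
  rintro ⟨g, hg, hfg⟩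
  exact h θ hθ ⟨fun r => ENNReal.ofReal (g r),
    ENNReal.continuous_ofReal.comp (continuous_of_absolutelyContinuousOnInterval hg), hfg⟩
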